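/- **Conventions.** A model category has finite limits and colimits and satisfies the usual axioms (Dwyer–Spalinski); functorial factorizations are not required. Let $\mathcal M$ be a model category. A *cofibrant replacement* of $X$ is a trivial fibration $q:QX\to X$ with $QX$ cofibrant, and a *fibrant replacement* of $Y$ is a trivial cofibration $r:Y\to RY$ with $RY$ fibrant. Two objects are *weakly equivalent* if they are connected by a zigzag of weak equivalences. A *Quillen adjunction* $F\dashv U$ is an adjunction in which $F$ preserves cofibrations and $U$ preserves fibrations. **Partial Quillen equivalences.** Let $F:\mathcal C\rightleftarrows\mathcal D:U$ be an adjunction between model categories with unit $\eta$ and counit $\epsilon$, and let $\mathcal C_0\subset\mathcal C$, $\mathcal D_0\subset\mathcal D$ be full subcategories. It is a *partial Quillen equivalence for $\mathcal C_0$ and $\mathcal D_0$* if it is a Quillen adjunction and 1. an object weakly equivalent to an object of $\mathcal C_0$ lies in $\mathcal C_0$, and likewise for $\mathcal D_0$; 2. $FX\in\mathcal D_0$ for every cofibrant $X\in\mathcal C_0$, and $UY\in\mathcal C_0$ for every fibrant $Y\in\mathcal D_0$; 3. for every cofibrant $X\in\mathcal C_0$ and every fibrant replacement $r:FX\to RFX$,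 the derived unit $U(r)\circ\eta_X:X\to URFX$ is a weak equivalence; and for every fibrant $Y\in\mathcal D_0$ and every cofibrant replacement $q:QUY\to UY$, the derived counit $\epsilon_Y\circ F(q):FQUY\to Y$ is a weak equivalence. **Extended tame functors.** Let $\mathbb R_+=([0,\infty),\le)$, regarded as a category. A strictly increasing sequence $\tau_0<\tau_1<\cdots$ in $[0,\infty)$ that is finite or divergent *discretises* $X:\mathbb R_+\to\mathcal M$ if $X(s\le t)$ is an isomorphism whenever there is no $a$ with $s<\tau_a\le t$. The functor $X$ is *extended tame* if some such sequence discretises it. Let $\mathsf{et}(\mathcal M^{\mathbb R_+})$ be the full subcategory of $\mathcal M^{\mathbb R_+}$ of extended tame functors. For a full subcategory $\mathcal M_0\subset\mathcal M$, let $\mathsf{et}(\mathcal M_0^{\mathbb R_+})$ be the full subcategory of $\mathsf{et}(\mathcal M^{\mathbb R_+})$ of functors with all values in $\mathcal M_0$. If $\mathcal M$ is a model category, call $g:X\to Y$ in $\mathsf{et}(\mathcal M^{\mathbb R_+})$ a weak equivalence (fibration) if every $g(t)$ is one. Call $g$ a cofibration if for some sequence $0=\tau_0<\tau_1<\cdots$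 discretising both $X$ and $Y$ (equivalently, for every such sequence), $g(0)$ and, for all $a>0$, the induced morphisms $$Y(\tau_{a-1})\sqcup_{X(\tau_{a-1})}X(\tau_a)\longrightarrow Y(\tau_a)$$ are cofibrations in $\mathcal M$. **Proposition 4.5.** Let $\mathcal C$ and $\mathcal D$ be model categories and let $F:\mathcal C\rightleftarrows\mathcal D:U$ be a partial Quillen equivalence for the full subcategories $\mathcal C_0$ and $\mathcal D_0$. Then the classes above are model structures on $\mathsf{et}(\mathcal C^{\mathbb R_+})$ and $\mathsf{et}(\mathcal D^{\mathbb R_+})$. With respect to them, the adjunction obtained by applying $F$ and $U$ pointwise (with pointwise unit and counit), $$F_*:\mathsf{et}(\mathcal C^{\mathbb R_+})\rightleftarrows\mathsf{et}(\mathcal D^{\mathbb R_+}):U_*,$$ is a Quillen adjunction and is a partial Quillen equivalence for the full subcategories $\mathsf{et}(\mathcal C_0^{\mathbb R_+})$ and $\mathsf{et}(\mathcal D_0^{\mathbb R_+})$. -/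

import Mathlib

open CategoryTheory Limits HomotopicalAlgebra
open scoped NNReal

universe v₁ v₂ u₁ u₂

/-! ### Partial Quillen equivalences -/

namespace PartialQuillen

section

variable {C : Type u₁} [Category.{v₁} C] [ModelCategory C]

/-- Two objects are weakly equivalent if a zigzag of weak equivalences connects them. -/
def WeaklyEquivalent : C → C → Prop :=
  Relation.EqvGen fun X Y => ∃ f : X ⟶ Y, WeakEquivalence f

/-- A full subcategory, given by its objects, is closed under weak equivalences. -/
def ClosedUnderWeakEquivalences (P : ObjectProperty C) : Prop :=
  ∀ X Y : C, WeaklyEquivalent X Y → P X → P Y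

/-- `q : QX ⟶ X` is a cofibrant replacement of `X`. -/
structure IsCofibrantReplacement {QX X : C} (q : QX ⟶ X) : Prop where
  isCofibrant : IsCofibrant QX
  fibration : Fibration q
  weakEquivalence : WeakEquivalence q

/-- `r : Y ⟶ RY` is a fibrant replacement of `Y`. -/
structure IsFibrantReplacement {Y RY : C} (r : Y ⟶ RY) : Prop where
  isFibrant : IsFibrant RY
  cofibration : Cofibration r
  weakEquivalence : WeakEquivalence r

end

section

variable {C : Type u₁} [Category.{v₁} C] {D : Type u₂} [Category.{v₂} D]
  {F : C ⥤ D} {U : D ⥤ C}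

/-- The derived unit `X ⟶ UFX ⟶ U(RFX)` computed with a map `r : FX ⟶ RFX`. -/
def derivedUnit (adj : F ⊣ U) {X : C} {RFX : D} (r : F.obj X ⟶ RFX) : X ⟶ U.obj RFX :=
  adj.unit.app X ≫ U.map r

/-- The derived counit `F(QUY) ⟶ FUY ⟶ Y` computed with a map `q : QUY ⟶ UY`. -/
def derivedCounit (adj : F ⊣ U) {Y : D} {QUY : C} (q : QUY ⟶ U.obj Y) : F.obj QUY ⟶ Y :=
  F.map q ≫ adj.counit.app Y

variable [ModelCategory C] [ModelCategory D]

/-- An adjunction between model categories is a Quillen adjunction if the left adjoint preserves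
cofibrations and the right adjoint preserves fibrations. -/
structure IsQuillenAdjunction (_adj : F ⊣ U) : Prop where
  map_cofibration : ∀ {X Y : C} (f : X ⟶ Y), Cofibration f → Cofibration (F.map f)
  map_fibration : ∀ {X Y : D} (f : X ⟶ Y), Fibration f → Fibration (U.map f)

/-- The adjunction `F ⊣ U` is a partial Quillen equivalence for the full subcategories with
objects `C₀` and `D₀`. -/
structure IsPartialQuillenEquivalence (adj : F ⊣ U) (C₀ : ObjectProperty C)
    (D₀ : ObjectProperty D) : Prop extends IsQuillenAdjunction adj where
  closed_left : ClosedUnderWeakEquivalences C₀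
  closed_right : ClosedUnderWeakEquivalences D₀
  obj_left : ∀ X : C, IsCofibrant X → C₀ X → D₀ (F.obj X)
  obj_right : ∀ Y : D, IsFibrant Y → D₀ Y → C₀ (U.obj Y)
  derivedUnit_weakEquivalence : ∀ X : C, IsCofibrant X → C₀ X →
    ∀ (RFX : D) (r : F.obj X ⟶ RFX), IsFibrantReplacement r →
      WeakEquivalence (derivedUnit adj r)
  derivedCounit_weakEquivalence : ∀ Y : D, IsFibrant Y → D₀ Y →
    ∀ (QUY : C) (q : QUY ⟶ U.obj Y), IsCofibrantReplacement q →
      WeakEquivalence (derivedCounit adj q)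

end

end PartialQuillen

/-! ### Extended tame functors -/

namespace ExtendedTame

/-- The sets of terms of the sequences `τ₀ < τ₁ < ⋯` in `[0, ∞)` that are finite or divergent. -/
def IsDiscreteSequence (S : Set ℝ≥0) : Prop :=
  S.Finite ∨ ∃ τ : ℕ → ℝ≥0, StrictMono τ ∧ Filter.Tendsto τ Filter.atTop Filter.atTop ∧
    Set.range τ = S

section

variable {C : Type u₁} [Category.{v₁} C]

/-- The sequence with set of terms `S` discretises `X`: the morphism `X(s ≤ t)` may fail to be an
isomorphism only if `s < a ≤ t` for some term `a`. -/
def Discretises (S : Set ℝ≥0) (X : ℝ≥0 ⥤ C) : Prop :=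
  ∀ (s t : ℝ≥0) (h : s ≤ t), ¬ IsIso (X.map (homOfLE h)) → ∃ a ∈ S, s < a ∧ a ≤ t

variable (C) in
/-- The property of being an extended tame functor. -/
def isExtendedTame : ObjectProperty (ℝ≥0 ⥤ C) :=
  fun X => ∃ S : Set ℝ≥0, IsDiscreteSequence S ∧ Discretises S X

variable (C) in
/-- The category of extended tame functors `[0, ∞) ⥤ C`. -/
abbrev Et : Type (max u₁ v₁) := (isExtendedTame C).FullSubcategory

/-- For a full subcategory of `C` with objects `C₀`, the full subcategory of the category of
extended tame functors whose objects are the functors with values in `C₀`. -/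
def etObjects (C₀ : ObjectProperty C) : ObjectProperty (Et C) :=
  fun X => ∀ t : ℝ≥0, C₀ (X.obj.obj t)

/-- The morphism `Y(s) ⊔_{X(s)} X(t) ⟶ Y(t)` induced by `g : X ⟶ Y` for `s ≤ t`. -/
noncomputable def cornerMap [HasPushouts C] {X Y : ℝ≥0 ⥤ C} (g : X ⟶ Y) {s t : ℝ≥0}
    (h : s ≤ t) : pushout (g.app s) (X.map (homOfLE h)) ⟶ Y.obj t :=
  pushout.desc (Y.map (homOfLE h)) (g.app t) (g.naturality (homOfLE h)).symm

section

variable (C) [ModelCategory C]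

/-- Pointwise weak equivalences. -/
def etWeakEquivalences : MorphismProperty (Et C) :=
  fun _ _ g => ∀ t : ℝ≥0, WeakEquivalence (g.hom.app t)

/-- Pointwise fibrations. -/
def etFibrations : MorphismProperty (Et C) :=
  fun _ _ g => ∀ t : ℝ≥0, Fibration (g.hom.app t)

/-- The cofibrations `g : X ⟶ Y` between extended tame functors. Let `0 = τ₀ < τ₁ < ⋯` be a
sequence that discretises both `X` and `Y`. The morphism `g` factors through a functor `Q`
with `Q(0) = X(0)` and `Q(τ_a) = Y(τ_{a-1}) ⊔_{X(τ_{a-1})} X(τ_a)` for `a > 0`, extended to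
`[0, ∞)` so as to be constant between successive terms, and `g` is a cofibration if `Q ⟶ Y` is
one at every time. It suffices to test this at the times `τ_a`, where `Q ⟶ Y` is `g(0)` for
`a = 0` and the corner map between successive terms for `a > 0`. The condition does not depend
on the sequence: new terms between two old ones give corner maps that are isomorphisms, or are
isomorphic to old ones. -/
def etCofibrations : MorphismProperty (Et C) :=
  fun X Y g => ∃ S : Set ℝ≥0, IsDiscreteSequence S ∧ 0 ∈ S ∧
    Discretises S X.obj ∧ Discretises S Y.obj ∧
    Cofibration (g.hom.app 0) ∧
    ∀ s ∈ S, ∀ t ∈ S, ∀ h : s < t, (∀ u ∈ S, ¬ (s < u ∧ u < t)) →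
      Cofibration (cornerMap g.hom h.le)

variable {C} in
/-- The model structure `m` on the category of extended tame functors is the one with the three
classes above. -/
structure IsStandardModelStructure (m : ModelCategory (Et C)) : Prop where
  weakEquivalences_eq : weakEquivalences (Et C) = etWeakEquivalences C
  fibrations_eq : fibrations (Et C) = etFibrations C
  cofibrations_eq : cofibrations (Et C) = etCofibrations C

end

end

section

variable {C : Type u₁} [Category.{v₁} C] {D : Type u₂} [Category.{v₂} D]

theorem isExtendedTame_comp (F : C ⥤ D) {X : ℝ≥0 ⥤ C} (hX : isExtendedTame C X) :
    isExtendedTame D (X ⋙ F) := by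
  obtain ⟨S, hS, h⟩ := hX
  refine ⟨S, hS, fun s t hst hni => h s t hst fun hi => hni ?_⟩
  rw [Functor.comp_map]
  infer_instance

/-- The functor between categories of extended tame functors given by postcomposition. -/
def etMap (F : C ⥤ D) : Et C ⥤ Et D :=
  (isExtendedTame D).lift
    ((isExtendedTame C).ι ⋙ (Functor.whiskeringRight ℝ≥0 C D).obj F)
    fun X => isExtendedTame_comp F X.property

/-- The adjunction between categories of extended tame functors whose unit and counit are
pointwise those of `F ⊣ U`. -/
def etAdjunction {F : C ⥤ D} {U : D ⥤ C} (adj : F ⊣ U) : etMap F ⊣ etMap U where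
  unit :=
    { app := fun X => ObjectProperty.homMk
        { app := fun t => adj.unit.app (X.obj.obj t)
          naturality := fun _ _ f => adj.unit.naturality (X.obj.map f) }
      naturality := fun _ _ g => by
        ext t
        exact adj.unit.naturality (g.hom.app t) }
  counit :=
    { app := fun Y => ObjectProperty.homMk
        { app := fun t => adj.counit.app (Y.obj.obj t)
          naturality := fun _ _ f => adj.counit.naturality (Y.obj.map f) }
      naturality := fun _ _ g => by
        ext t
        exact adj.counit.naturality (g.hom.app t) }
  left_triangle_components := fun X => by
    ext t
    exact adj.left_triangle_components (X.obj.obj t)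
  right_triangle_components := fun Y => by
    ext t
    exact adj.right_triangle_components (Y.obj.obj t)

end

end ExtendedTame

/-! The key is to describe cofibrations without a sequence: `g` is one exactly when all its
components and its corner maps at all `s ≤ t` are cofibrations in `C` (`etCofibrations_iff`). This
works because the corner map of a composite is a cobase change of the first corner map followed by
the second (`isPushout_cornerStep`, `cornerStep_corner`).

Finitely many extended tame functors share a sequence `τ` indexed by `ℕ` and discretising them all,
and are recovered from their restrictions to `τ` by rounding down. Lifts and factorizations over `ℕ`
are built by recursion, each step solving a problem in `C` posed by a corner map. The argument
serves both weak factorization systems, because by two-out-of-three the trivial cofibrations are the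
maps with components and corner maps trivial cofibrations (`cornerClass_trivialCofibrations_iff`).

For the adjunction, `F` preserves pushouts and hence corner maps. Evaluation at `t` preserves
cofibrant objects, fibrant objects and both kinds of replacement, so every remaining condition is
checked pointwise. -/

namespace ExtendedTame

open MorphismProperty

/-! ### Corner maps and their composition. -/

section Corner

variable {J : Type u₂} [Category.{v₂} J] {C : Type u₁} [Category.{v₁} C] [HasPushouts C]
  {X Y : J ⥤ C} (g : X ⟶ Y)

/-- The morphism `Y(s) ⊔_{X(s)} X(t) ⟶ Y(t)` induced by `g : X ⟶ Y` and `u : s ⟶ t`. -/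
noncomputable def corner {s t : J} (u : s ⟶ t) :
    pushout (g.app s) (X.map u) ⟶ Y.obj t :=
  pushout.desc (Y.map u) (g.app t) (g.naturality u).symm

@[simp]
lemma inl_corner {s t : J} (u : s ⟶ t) : pushout.inl _ _ ≫ corner g u = Y.map u :=
  pushout.inl_desc _ _ _

@[simp]
lemma inr_corner {s t : J} (u : s ⟶ t) : pushout.inr _ _ ≫ corner g u = g.app t :=
  pushout.inr_desc _ _ _

@[simp]
lemma inl_corner_assoc {s t : J} (u : s ⟶ t) {W : C} (h : Y.obj t ⟶ W) :
    pushout.inl _ _ ≫ corner g u ≫ h = Y.map u ≫ h := by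
  rw [← Category.assoc, inl_corner]

@[simp]
lemma inr_corner_assoc {s t : J} (u : s ⟶ t) {W : C} (h : Y.obj t ⟶ W) :
    pushout.inr _ _ ≫ corner g u ≫ h = g.app t ≫ h := by
  rw [← Category.assoc, inr_corner]

/-- The comparison between the domains of the corner maps of `u ≫ v` and of `v`. -/
noncomputable def cornerStep {r s t : J} (u : r ⟶ s) (v : s ⟶ t) :
    pushout (g.app r) (X.map (u ≫ v)) ⟶ pushout (g.app s) (X.map v) :=
  pushout.desc (Y.map u ≫ pushout.inl _ _) (pushout.inr _ _) (by
    rw [← Category.assoc, ← g.naturality, Category.assoc, pushout.condition, X.map_comp,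
      Category.assoc])

lemma cornerStep_corner {r s t : J} (u : r ⟶ s) (v : s ⟶ t) :
    cornerStep g u v ≫ corner g v = corner g (u ≫ v) := by
  apply pushout.hom_ext <;>
    simp [cornerStep, pushout.inl_desc_assoc, pushout.inr_desc_assoc]

/-- Pushout cancellation: stacked below the cobase change of `X.map v` to `Y(r) ⊔ X(s)`, this square
gives the pushout square of `g.app s` and `X.map v`. -/
lemma isPushout_cornerStep {r s t : J} (u : r ⟶ s) (v : s ⟶ t) :
    IsPushout (pushout.desc (pushout.inl _ _) (X.map v ≫ pushout.inr _ _)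
        (by rw [pushout.condition, X.map_comp, Category.assoc]) :
        pushout (g.app r) (X.map u) ⟶ pushout (g.app r) (X.map (u ≫ v)))
      (corner g u) (cornerStep g u v) (pushout.inl _ _) := by
  have h₁ : IsPushout (X.map u) (g.app r) (pushout.inr (g.app r) (X.map u)) (pushout.inl _ _) :=
    (IsPushout.of_hasPushout _ _).flip
  have h₂ : IsPushout (X.map u ≫ X.map v) (g.app r)
      (pushout.inr (g.app r) (X.map (u ≫ v))) (pushout.inl (g.app r) (X.map u) ≫
        pushout.desc (pushout.inl _ _) (X.map v ≫ pushout.inr _ _)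
        (by rw [pushout.condition, X.map_comp, Category.assoc])) := by
    rw [pushout.inl_desc, ← X.map_comp]
    exact (IsPushout.of_hasPushout _ _).flip
  have h₃ := h₂.of_left (by rw [pushout.inr_desc]) h₁
  refine IsPushout.of_top (h₁₁ := X.map v) (v₁₁ := pushout.inr _ _) (v₁₂ := pushout.inr _ _)
    ?_ ?_ h₃
  · rw [inr_corner, cornerStep, pushout.inr_desc]
    exact (IsPushout.of_hasPushout _ _).flip
  · apply pushout.hom_ext
    · simp [cornerStep, pushout.inl_desc, pushout.inl_desc_assoc]
    · simp [cornerStep, pushout.inr_desc, pushout.inr_desc_assoc, pushout.condition]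

lemma isIso_corner {s t : J} (u : s ⟶ t) [IsIso (X.map u)] [IsIso (Y.map u)] :
    IsIso (corner g u) := by
  have : IsIso (pushout.inl (g.app s) (X.map u) ≫ corner g u) := by
    rw [inl_corner]; infer_instance
  exact IsIso.of_isIso_comp_left (pushout.inl (g.app s) (X.map u)) _

variable (L : MorphismProperty C)

variable {L} in
lemma corner_comp_mem [L.IsStableUnderCobaseChange] [L.IsStableUnderComposition]
    {r s t : J} (u : r ⟶ s) (v : s ⟶ t) (hu : L (corner g u)) (hv : L (corner g v)) :
    L (corner g (u ≫ v)) := by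
  rw [← cornerStep_corner]
  exact L.comp_mem _ _ (of_isPushout (isPushout_cornerStep g u v) hu) hv

-- An invertible corner map at `u` makes the comparison of domains invertible, so the other two
-- corner maps agree up to isomorphism.
variable {L} in
lemma corner_mem_of_comp [L.RespectsIso]
    {r s t : J} (u : r ⟶ s) (v : s ⟶ t) [IsIso (corner g u)] (huv : L (corner g (u ≫ v))) :
    L (corner g v) := by
  have : IsIso (cornerStep g u v) :=
    (isomorphisms C).of_isPushout (isPushout_cornerStep g u v)
      (isomorphisms.infer_property (corner g u))
  rw [← cornerStep_corner] at huv
  exact (L.cancel_left_of_respectsIso _ _).1 huv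

variable {L} in
lemma app_mem_of_corner_mem [L.IsStableUnderCobaseChange] [L.IsStableUnderComposition]
    {s t : J} (u : s ⟶ t) (hs : L (g.app s)) (hu : L (corner g u)) : L (g.app t) := by
  rw [← inr_corner g u]
  exact L.comp_mem _ _ (of_isPushout (IsPushout.of_hasPushout _ _).flip hs) hu

/-- The functor sending a natural transformation to its corner map at `u : s ⟶ t`. -/
noncomputable def cornerFunctor {s t : J} (u : s ⟶ t) : Arrow (J ⥤ C) ⥤ Arrow C where
  obj g := Arrow.mk (corner g.hom u)
  map {g g'} φ := Arrow.homMk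
    (pushout.map _ _ _ _ (φ.right.app s) (φ.left.app t) (φ.left.app s)
      (by simp [← NatTrans.comp_app]) (by simp))
    (φ.right.app t)
    (by
      apply pushout.hom_ext
      · simp [pushout.inl_desc_assoc]
      · simp [pushout.inr_desc_assoc, ← NatTrans.comp_app])
  map_id g := by
    ext
    · apply pushout.hom_ext <;> simp
    · simp
  map_comp φ ψ := by
    ext
    · apply pushout.hom_ext <;>
        simp [pushout.inl_desc, pushout.inr_desc, pushout.inl_desc_assoc, pushout.inr_desc_assoc]
    · simp

/-- The natural transformations whose components and corner maps all belong to `L`. -/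
def cornerClass : MorphismProperty (J ⥤ C) := fun _ _ g =>
  (∀ t, L (g.app t)) ∧ ∀ (s t : J) (u : s ⟶ t), L (corner g u)

instance [L.IsStableUnderRetracts] : (cornerClass (J := J) L).IsStableUnderRetracts where
  of_retract {A B A' B' f f'} h hf := by
    refine ⟨fun t => ?_, fun s t u => ?_⟩
    · exact of_retract (P := L) (h.map ((evaluation J C).obj t)) (hf.1 t)
    · exact of_retract (P := L) (Retract.map h (cornerFunctor u)) (hf.2 s t u)

variable {L}

lemma cornerClass_whiskerLeft {K : Type*} [Category K] (E : K ⥤ J) (hg : cornerClass L g) :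
    cornerClass L (Functor.whiskerLeft E g) :=
  ⟨fun t => hg.1 (E.obj t), fun s t u => hg.2 (E.obj s) (E.obj t) (E.map u)⟩

end Corner

/-! ### Corner maps under a pushout-preserving functor. -/

section Image

variable {J : Type*} [Category J] {C : Type u₁} [Category.{v₁} C] [HasPushouts C]
  {D : Type u₂} [Category.{v₂} D] [HasPushouts D] {L : MorphismProperty C}
  {L' : MorphismProperty D}

lemma cornerClass_whiskerRight [L'.RespectsIso] {X Y : J ⥤ C} {g : X ⟶ Y} (F : C ⥤ D)
    [PreservesColimitsOfShape WalkingSpan F]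
    (hF : ∀ ⦃A B : C⦄ (f : A ⟶ B), L f → L' (F.map f)) (hg : cornerClass L g) :
    cornerClass L' (Functor.whiskerRight g F) := by
  refine ⟨fun t => hF _ (hg.1 t), fun s t u => ?_⟩
  have h := hF _ (hg.2 s t u)
  have e : corner (Functor.whiskerRight g F) u =
      (PreservesPushout.iso F (g.app s) (X.map u)).hom ≫ F.map (corner g u) := by
    apply pushout.hom_ext
    · rw [inl_corner]
      erw [PreservesPushout.inl_iso_hom_assoc]
      rw [← F.map_comp, inl_corner]
      rfl
    · rw [inr_corner]
      erw [PreservesPushout.inr_iso_hom_assoc]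
      rw [← F.map_comp, inr_corner]
      rfl
  rw [e]
  exact (L'.cancel_left_of_respectsIso _ _).2 h

end Image

end ExtendedTame
namespace ExtendedTame

/-! ### Divergent sequences and rounding down. -/

section Sequences

lemma IsDiscreteSequence.finite_inter_Iic {S : Set ℝ≥0} (hS : IsDiscreteSequence S) (b : ℝ≥0) :
    (S ∩ Set.Iic b).Finite := by
  obtain hS | ⟨τ, -, hτ, rfl⟩ := hS
  · exact hS.subset Set.inter_subset_left
  · obtain ⟨N, hN⟩ := Filter.eventually_atTop.1 (hτ.eventually_gt_atTop b)
    refine ((Set.finite_lt_nat N).image τ).subset ?_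
    rintro _ ⟨⟨n, rfl⟩, hn⟩
    refine ⟨n, ?_, rfl⟩
    by_contra h
    exact absurd (hN n (not_lt.1 h)) (not_lt.2 hn)

/-- A strictly increasing divergent sequence in `[0, ∞)` starting at `0`. -/
structure IsGrid (τ : ℕ → ℝ≥0) : Prop where
  strictMono : StrictMono τ
  tendsto : Filter.Tendsto τ Filter.atTop Filter.atTop
  zero : τ 0 = 0

lemma IsGrid.isDiscreteSequence {τ : ℕ → ℝ≥0} (hτ : IsGrid τ) :
    IsDiscreteSequence (Set.range τ) :=
  Or.inr ⟨τ, hτ.strictMono, hτ.tendsto, rfl⟩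

lemma exists_isGrid {S : Set ℝ≥0} (hS : ∀ b, (S ∩ Set.Iic b).Finite) :
    ∃ τ : ℕ → ℝ≥0, IsGrid τ ∧ S ⊆ Set.range τ := by
  classical
  -- Adding the natural numbers keeps the set locally finite while making it unbounded with least
  -- element `0`, hence order isomorphic to `ℕ`.
  let T : Set ℝ≥0 := S ∪ Set.range (fun n : ℕ => (n : ℝ≥0))
  have hN : ∀ n : ℕ, (n : ℝ≥0) ∈ T := fun n => Or.inr ⟨n, rfl⟩
  have hT : ∀ b, (T ∩ Set.Iic b).Finite := fun b => by
    rw [Set.union_inter_distrib_right]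
    refine (hS b).union (((Set.finite_le_nat ⌊b⌋₊).image (fun n : ℕ => (n : ℝ≥0))).subset ?_)
    rintro _ ⟨⟨n, rfl⟩, hn⟩
    exact ⟨n, Nat.le_floor hn, rfl⟩
  let i₁ : LocallyFiniteOrder T := LocallyFiniteOrder.ofFiniteIcc fun a b => by
    refine Set.Finite.of_finite_image ((hT b).subset ?_) Subtype.val_injective.injOn
    rintro _ ⟨x, hx, rfl⟩
    exact ⟨x.2, hx.2⟩
  let i₂ : SuccOrder T := LinearLocallyFiniteOrder.succOrder T
  let i₃ : PredOrder T := LinearLocallyFiniteOrder.predOrder T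
  let i₄ : OrderBot T := { bot := ⟨0, by simpa using hN 0⟩, bot_le := fun x => zero_le (a := (x : ℝ≥0)) }
  have i₅ : NoMaxOrder T := ⟨fun a => by
    obtain ⟨n, hn⟩ := exists_nat_gt (a : ℝ≥0)
    exact ⟨⟨n, hN n⟩, hn⟩⟩
  let e : T ≃o ℕ := orderIsoNatOfLinearSuccPredArch
  refine ⟨fun n => (e.symm n : ℝ≥0), ⟨fun m n h => e.symm.strictMono h, ?_, ?_⟩, fun x hx => ?_⟩
  · refine Filter.tendsto_atTop_atTop_of_monotone (fun m n h => e.symm.monotone h) fun b => ?_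
    obtain ⟨n, hn⟩ := exists_nat_ge b
    exact ⟨e ⟨n, hN n⟩, by simpa using hn⟩
  · have h : e.symm 0 = ⊥ := e.symm.map_bot
    simp only [h]
    rfl
  · exact ⟨e ⟨x, Or.inl hx⟩, by simp⟩

namespace IsGrid

variable {τ : ℕ → ℝ≥0}

lemma exists_lt (hτ : IsGrid τ) (t : ℝ≥0) : ∃ n, t < τ (n + 1) :=
  ((hτ.tendsto.comp (Filter.tendsto_add_atTop_nat 1)).eventually_gt_atTop t).exists

variable (hτ : IsGrid τ)

open Classical in
/-- The index of the largest term of a sequence that is at most `t`. -/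
noncomputable def floor (t : ℝ≥0) : ℕ := Nat.find (hτ.exists_lt t)

lemma le_floor_iff (n : ℕ) (t : ℝ≥0) : n ≤ hτ.floor t ↔ τ n ≤ t := by
  classical
  rw [floor, Nat.le_find_iff]
  simp only [not_lt]
  constructor
  · intro h
    cases n with
    | zero => rw [hτ.zero]; exact zero_le
    | succ k => exact h k (Nat.lt_succ_self k)
  · exact fun h m hm => (hτ.strictMono.monotone (Nat.succ_le_of_lt hm)).trans h

lemma floor_monotone : Monotone hτ.floor := fun _ _ h =>
  (hτ.le_floor_iff _ _).2 (((hτ.le_floor_iff _ _).1 le_rfl).trans h)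

lemma apply_floor_le (t : ℝ≥0) : τ (hτ.floor t) ≤ t := (hτ.le_floor_iff _ _).1 le_rfl

/-- The inclusion of the terms of the sequence, as a functor. -/
abbrev incl : ℕ ⥤ ℝ≥0 := hτ.strictMono.monotone.functor

/-- Rounding down to a term of the sequence, as a functor. -/
noncomputable abbrev floorFunctor : ℝ≥0 ⥤ ℕ := hτ.floor_monotone.functor

end IsGrid

end Sequences

/-! ### Recovering a functor from a discretising sequence. -/

section Discretises

variable {C : Type u₁} [Category.{v₁} C]

lemma Discretises.mono {S T : Set ℝ≥0} {X : ℝ≥0 ⥤ C} (hX : Discretises S X) (h : S ⊆ T) :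
    Discretises T X := fun s t hst hi => by
  obtain ⟨a, ha, ha'⟩ := hX s t hst hi
  exact ⟨a, h ha, ha'⟩

lemma Discretises.isIso {S : Set ℝ≥0} {X : ℝ≥0 ⥤ C} (hX : Discretises S X) {s t : ℝ≥0}
    (u : s ⟶ t) (h : ∀ a ∈ S, s < a → ¬ a ≤ t) : IsIso (X.map u) := by
  by_contra hi
  obtain ⟨a, ha, h₁, h₂⟩ := hX s t (leOfHom u) hi
  exact h a ha h₁ h₂

/-- Finitely many extended tame functors have a common discretising sequence. -/
lemma exists_isGrid_discretises {ι : Type*} [Finite ι] (X : ι → ℝ≥0 ⥤ C)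
    (hX : ∀ i, isExtendedTame C (X i)) :
    ∃ τ, IsGrid τ ∧ ∀ i, Discretises (Set.range τ) (X i) := by
  choose S hS hSX using hX
  obtain ⟨τ, hτ, h⟩ := exists_isGrid (S := ⋃ i, S i) fun b => by
    rw [Set.iUnion_inter]
    exact Set.finite_iUnion fun i => (hS i).finite_inter_Iic b
  exact ⟨τ, hτ, fun i => (hSX i).mono ((Set.subset_iUnion S i).trans h)⟩

namespace IsGrid

variable {τ : ℕ → ℝ≥0} (hτ : IsGrid τ)

lemma discretises_floorFunctor_comp (Z : ℕ ⥤ C) :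
    Discretises (Set.range τ) (hτ.floorFunctor ⋙ Z) := by
  intro s t h hi
  have hlt : hτ.floor s < hτ.floor t := by
    refine (hτ.floor_monotone h).lt_of_ne fun heq => hi ?_
    have : IsIso (hτ.floorFunctor.map (homOfLE h)) := ⟨homOfLE heq.ge, rfl, rfl⟩
    rw [Functor.comp_map]
    infer_instance
  refine ⟨_, ⟨hτ.floor t, rfl⟩, ?_, hτ.apply_floor_le t⟩
  by_contra hle
  exact absurd ((hτ.le_floor_iff _ _).2 (not_lt.1 hle)) (not_le.2 hlt)

/-- The extended tame functor that is constant between successive terms of a sequence. -/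
noncomputable def extend (Z : ℕ ⥤ C) : Et C :=
  ⟨hτ.floorFunctor ⋙ Z, _, hτ.isDiscreteSequence, hτ.discretises_floorFunctor_comp Z⟩

/-- The comparison of a functor with its extension from the terms of a sequence. -/
noncomputable def comparison (X : ℝ≥0 ⥤ C) : hτ.floorFunctor ⋙ hτ.incl ⋙ X ⟶ X where
  app t := X.map (homOfLE (hτ.apply_floor_le t))
  naturality s t u := by
    simp only [Functor.comp_map, ← X.map_comp]
    rfl

lemma comparison_naturality {X Y : ℝ≥0 ⥤ C} (f : X ⟶ Y) :
    Functor.whiskerLeft hτ.floorFunctor (Functor.whiskerLeft hτ.incl f) ≫ hτ.comparison Y =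
      hτ.comparison X ≫ f := by
  ext t
  exact (f.naturality _).symm

lemma comparison_naturality_assoc {X Y Z : ℝ≥0 ⥤ C} (f : X ⟶ Y) (h : Y ⟶ Z) :
    Functor.whiskerLeft hτ.floorFunctor (Functor.whiskerLeft hτ.incl f) ≫ hτ.comparison Y ≫ h =
      hτ.comparison X ≫ f ≫ h := by
  rw [← Category.assoc, hτ.comparison_naturality, Category.assoc]

lemma isIso_comparison {X : ℝ≥0 ⥤ C} (hX : Discretises (Set.range τ) X) :
    IsIso (hτ.comparison X) := by
  have (t : ℝ≥0) : IsIso ((hτ.comparison X).app t) := hX.isIso _ <| by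
    rintro _ ⟨n, rfl⟩ h h'
    exact absurd (hτ.strictMono.monotone ((hτ.le_floor_iff n t).2 h')) (not_le.2 h)
  exact NatIso.isIso_of_isIso_app _

end IsGrid

end Discretises

end ExtendedTame
namespace ExtendedTame

open MorphismProperty

/-! ### Lifting and factorization for functors on `ℕ`. -/

section Sequence

variable {C : Type u₁} [Category.{v₁} C] [HasPushouts C] {L R : MorphismProperty C}

lemma cornerClass_of_succ [L.IsStableUnderCobaseChange] [L.IsMultiplicative]
    {X Y : ℕ ⥤ C} {g : X ⟶ Y} (h₀ : L (g.app 0))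
    (h : ∀ n, L (corner g (homOfLE (Nat.le_add_right n 1)))) : cornerClass L g := by
  have : L.RespectsIso := inferInstance
  have key (s k : ℕ) : L (corner g (homOfLE (Nat.le_add_right s k))) := by
    induction k with
    | zero =>
      have : IsIso (homOfLE (Nat.le_add_right s 0)) := ⟨homOfLE le_rfl, rfl, rfl⟩
      have := isIso_corner g (homOfLE (Nat.le_add_right s 0))
      exact L.of_isIso _
    | succ k ih => exact corner_comp_mem g _ _ ih (h (s + k))
  refine ⟨fun t => ?_, fun s t u => ?_⟩
  · induction t with
    | zero => exact h₀
    | succ n ih => exact app_mem_of_corner_mem g _ ih (h n)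
  · obtain ⟨k, rfl⟩ := Nat.exists_eq_add_of_le (leOfHom u)
    exact key s k

/-- A lift at `n` and the map `u` at `n + 1` glue to a map out of the domain of the corner map of
`i`; lifting that corner map against `p` extends the lift naturally to `n + 1`. -/
lemma hasLiftingProperty_of_cornerClass {A B X Y : ℕ ⥤ C} {i : A ⟶ B} {p : X ⟶ Y}
    (hLR : ∀ ⦃A B X Y : C⦄ (i : A ⟶ B) (p : X ⟶ Y), L i → R p → HasLiftingProperty i p)
    (hi : cornerClass L i) (hp : ∀ n, R (p.app n)) : HasLiftingProperty i p where
  sq_hasLift {u v} sq := by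
    have w (n : ℕ) : u.app n ≫ p.app n = i.app n ≫ v.app n := congr_app sq.w n
    let Lift (n : ℕ) : Type _ :=
      { l : B.obj n ⟶ X.obj n // i.app n ≫ l = u.app n ∧ l ≫ p.app n = v.app n }
    have start : Nonempty (Lift 0) := by
      have := hLR _ _ (hi.1 0) (hp 0)
      have sq₀ : CommSq (u.app 0) (i.app 0) (p.app 0) (v.app 0) := ⟨w 0⟩
      exact ⟨sq₀.lift, sq₀.fac_left, sq₀.fac_right⟩
    have next (n : ℕ) (l : Lift n) : ∃ l' : Lift (n + 1),
        B.map (homOfLE (Nat.le_add_right n 1)) ≫ l'.1 =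
          l.1 ≫ X.map (homOfLE (Nat.le_add_right n 1)) := by
      have := hLR _ _ (hi.2 _ _ (homOfLE (Nat.le_add_right n 1))) (hp (n + 1))
      have sq' : CommSq (pushout.desc (l.1 ≫ X.map (homOfLE (Nat.le_add_right n 1)))
          (u.app (n + 1)) (by rw [← Category.assoc, l.2.1, u.naturality]))
          (corner i (homOfLE (Nat.le_add_right n 1))) (p.app (n + 1)) (v.app (n + 1)) := ⟨by
        apply pushout.hom_ext
        · rw [pushout.inl_desc_assoc, inl_corner_assoc, Category.assoc, p.naturality,
            v.naturality, ← Category.assoc, l.2.2]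
        · rw [pushout.inr_desc_assoc, inr_corner_assoc, w]⟩
      refine ⟨⟨sq'.lift, ?_, sq'.fac_right⟩, ?_⟩
      · rw [← inr_corner i (homOfLE (Nat.le_add_right n 1)), Category.assoc, sq'.fac_left,
          pushout.inr_desc]
      · rw [← inl_corner i, Category.assoc, sq'.fac_left, pushout.inl_desc]
    choose nxt hnxt using next
    let l (n : ℕ) : Lift n := Nat.rec start.some nxt n
    exact ⟨⟨{
      l := NatTrans.ofSequence (fun n => (l n).1) fun n => hnxt n (l n)
      fac_left := by ext n; exact (l n).2.1
      fac_right := by ext n; exact (l n).2.2 }⟩⟩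

/-- Given `Z(n)`, factor the induced map `Z(n) ⊔_{X(n)} X(n+1) ⟶ Y(n+1)`. Its `L`-part is then, by
construction, the corner map of `i`. -/
lemma exists_factorization_cornerClass [L.IsStableUnderCobaseChange] [L.IsMultiplicative]
    [HasFactorization L R] {X Y : ℕ ⥤ C} (f : X ⟶ Y) :
    ∃ (Z : ℕ ⥤ C) (i : X ⟶ Z) (p : Z ⟶ Y), i ≫ p = f ∧ cornerClass L i ∧ ∀ n, R (p.app n) := by
  let step (n : ℕ) : n ⟶ n + 1 := homOfLE (Nat.le_add_right n 1)
  let γ (n : ℕ) (d : MapFactorizationData L R (f.app n)) :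
      pushout d.i (X.map (step n)) ⟶ Y.obj (n + 1) :=
    pushout.desc (d.p ≫ Y.map (step n)) (f.app (n + 1))
      (by rw [d.fac_assoc, f.naturality])
  let e (n : ℕ) (d : MapFactorizationData L R (f.app n)) :
      MapFactorizationData L R (γ n d) := factorizationData L R _
  let next (n : ℕ) (d : MapFactorizationData L R (f.app n)) :
      MapFactorizationData L R (f.app (n + 1)) :=
    { Z := (e n d).Z
      i := pushout.inr _ _ ≫ (e n d).i
      p := (e n d).p
      fac := by rw [Category.assoc, (e n d).fac, pushout.inr_desc]
      hi := L.comp_mem _ _ (of_isPushout (IsPushout.of_hasPushout _ _).flip d.hi) (e n d).hi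
      hp := (e n d).hp }
  let D (n : ℕ) : MapFactorizationData L R (f.app n) :=
    Nat.rec (factorizationData L R (f.app 0)) next n
  let ζ (n : ℕ) : (D n).Z ⟶ (D (n + 1)).Z := pushout.inl _ _ ≫ (e n (D n)).i
  have hζ (n : ℕ) : (Functor.ofSequence ζ).map (step n) = ζ n :=
    Functor.ofSequence_map_homOfLE_succ ζ n
  let i : X ⟶ Functor.ofSequence ζ := NatTrans.ofSequence (fun n => (D n).i) fun n => by
    rw [hζ]
    change X.map (step n) ≫ pushout.inr (D n).i (X.map (step n)) ≫ (e n (D n)).i =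
      (D n).i ≫ pushout.inl (D n).i (X.map (step n)) ≫ (e n (D n)).i
    rw [← pushout.condition_assoc]
  let p : Functor.ofSequence ζ ⟶ Y := NatTrans.ofSequence (fun n => (D n).p) fun n => by
    rw [hζ]
    change (pushout.inl (D n).i (X.map (step n)) ≫ (e n (D n)).i) ≫ (e n (D n)).p =
      (D n).p ≫ Y.map (step n)
    rw [Category.assoc, (e n (D n)).fac, pushout.inl_desc]
  refine ⟨Functor.ofSequence ζ, i, p, ?_, cornerClass_of_succ (D 0).hi fun n => ?_,
    fun n => (D n).hp⟩
  · ext n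
    exact (D n).fac
  · have : corner i (step n) = (e n (D n)).i := by
      apply pushout.hom_ext
      · rw [inl_corner, hζ]; rfl
      · rw [inr_corner]; rfl
    change L (corner i (step n))
    rw [this]
    exact (e n (D n)).hi

end Sequence

/-! ### Transfer from `ℕ` to extended tame functors. -/

section Transfer

variable {C : Type u₁} [Category.{v₁} C] [HasPushouts C] {L R : MorphismProperty C}

lemma et_hasLiftingProperty {A B X Y : Et C} {i : A ⟶ B} {p : X ⟶ Y}
    (hLR : ∀ ⦃A B X Y : C⦄ (i : A ⟶ B) (p : X ⟶ Y), L i → R p → HasLiftingProperty i p)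
    (hi : cornerClass L i.hom) (hp : ∀ t, R (p.hom.app t)) : HasLiftingProperty i p where
  sq_hasLift {u v} sq := by
    -- Only the comparisons of `A` and `B` must be invertible; for `X` and `Y` naturality suffices.
    obtain ⟨τ, hτ, h⟩ := exists_isGrid_discretises ![A.obj, B.obj] (by
      intro k; fin_cases k <;> exact ObjectProperty.FullSubcategory.property _)
    have := hτ.isIso_comparison (h 0)
    have := hτ.isIso_comparison (h 1)
    dsimp at *
    have := hasLiftingProperty_of_cornerClass hLR (cornerClass_whiskerLeft _ hτ.incl hi)
      (p := Functor.whiskerLeft hτ.incl p.hom) (fun n => hp (hτ.incl.obj n))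
    have w : u.hom ≫ p.hom = i.hom ≫ v.hom := congr_arg InducedCategory.Hom.hom sq.w
    have sq' : CommSq (Functor.whiskerLeft hτ.incl u.hom) (Functor.whiskerLeft hτ.incl i.hom)
        (Functor.whiskerLeft hτ.incl p.hom) (Functor.whiskerLeft hτ.incl v.hom) :=
      ⟨by rw [← Functor.whiskerLeft_comp, w, Functor.whiskerLeft_comp]⟩
    exact ⟨⟨{
      l := ObjectProperty.homMk (inv (hτ.comparison B.obj) ≫
        Functor.whiskerLeft hτ.floorFunctor sq'.lift ≫ hτ.comparison X.obj)
      fac_left := by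
        apply ObjectProperty.hom_ext
        change i.hom ≫ inv (hτ.comparison B.obj) ≫ _ = u.hom
        rw [← cancel_epi (hτ.comparison A.obj), ← hτ.comparison_naturality_assoc,
          IsIso.hom_inv_id_assoc, ← Functor.whiskerLeft_comp_assoc, sq'.fac_left,
          hτ.comparison_naturality]
      fac_right := by
        apply ObjectProperty.hom_ext
        change (inv (hτ.comparison B.obj) ≫ _ ≫ _) ≫ p.hom = v.hom
        rw [Category.assoc, Category.assoc, IsIso.inv_comp_eq, ← hτ.comparison_naturality,
          ← hτ.comparison_naturality, ← Functor.whiskerLeft_comp_assoc, sq'.fac_right] }⟩⟩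

lemma et_exists_factorization [L.IsStableUnderCobaseChange] [L.IsMultiplicative]
    [L.IsStableUnderRetracts] [R.RespectsIso] [HasFactorization L R] {X Y : Et C} (f : X ⟶ Y) :
    ∃ (Z : Et C) (i : X ⟶ Z) (p : Z ⟶ Y), i ≫ p = f ∧ cornerClass L i.hom ∧
      ∀ t, R (p.hom.app t) := by
  obtain ⟨τ, hτ, h⟩ := exists_isGrid_discretises ![X.obj, Y.obj] (by
    intro k; fin_cases k <;> exact ObjectProperty.FullSubcategory.property _)
  have := hτ.isIso_comparison (h 0)
  have := hτ.isIso_comparison (h 1)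
  dsimp at *
  obtain ⟨Z, i, p, fac, hi, hp⟩ := exists_factorization_cornerClass (L := L) (R := R)
    (Functor.whiskerLeft hτ.incl f.hom)
  have h_fac : (inv (hτ.comparison X.obj) ≫ Functor.whiskerLeft hτ.floorFunctor i) ≫
      Functor.whiskerLeft hτ.floorFunctor p ≫ hτ.comparison Y.obj = f.hom := by
    rw [Category.assoc, IsIso.inv_comp_eq, ← Functor.whiskerLeft_comp_assoc, fac,
      hτ.comparison_naturality]
  refine ⟨hτ.extend Z,
    ObjectProperty.homMk (inv (hτ.comparison X.obj) ≫ Functor.whiskerLeft hτ.floorFunctor i),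
    ObjectProperty.homMk (Functor.whiskerLeft hτ.floorFunctor p ≫ hτ.comparison Y.obj),
    ?_, ?_, fun t => ?_⟩
  · exact ObjectProperty.hom_ext _ h_fac
  · exact ((cornerClass L).cancel_left_of_respectsIso _ _).2
      (cornerClass_whiskerLeft i hτ.floorFunctor hi)
  · exact (R.cancel_right_of_respectsIso _ _).2 (hp (hτ.floor t))

end Transfer

end ExtendedTame
namespace ExtendedTame

open MorphismProperty

/-! ### Finite limits and colimits. -/

section Limits

variable {C : Type u₁} [Category.{v₁} C] (J : Type*) [Category J] [Finite J]

instance [HasLimitsOfShape J C] : (isExtendedTame C).IsClosedUnderLimitsOfShape J where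
  limitsOfShape_le := by
    rintro X ⟨h⟩
    obtain ⟨τ, hτ, hd⟩ := exists_isGrid_discretises h.diag.obj h.prop_diag_obj
    refine ⟨_, hτ.isDiscreteSequence, fun s t hst hni => ?_⟩
    by_contra! ha
    refine hni ?_
    -- Limits are pointwise, so `X(s ≤ t)` is the map of limits induced by `α`, which is invertible
    -- when no common term lies in `(s, t]`.
    let α : h.diag ⋙ (evaluation ℝ≥0 C).obj s ⟶ h.diag ⋙ (evaluation ℝ≥0 C).obj t :=
      Functor.whiskerLeft h.diag ((evaluation ℝ≥0 C).map (homOfLE hst))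
    have (j : J) : IsIso (α.app j) :=
      (hd j).isIso (homOfLE hst) fun a ha' h₁ => not_le.2 (ha a ha' h₁)
    have : IsIso α := NatIso.isIso_of_isIso_app _
    let hs := isLimitOfPreserves ((evaluation ℝ≥0 C).obj s) h.isLimit
    let ht := isLimitOfPreserves ((evaluation ℝ≥0 C).obj t) h.isLimit
    have e : X.map (homOfLE hst) = (IsLimit.conePointsIsoOfNatIso hs ht (asIso α)).hom :=
      ht.hom_ext fun j => by
        rw [IsLimit.conePointsIsoOfNatIso_hom_comp]
        exact (h.π.app j).naturality (homOfLE hst)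
    rw [e]
    infer_instance

instance [HasColimitsOfShape J C] : (isExtendedTame C).IsClosedUnderColimitsOfShape J where
  colimitsOfShape_le := by
    rintro X ⟨h⟩
    obtain ⟨τ, hτ, hd⟩ := exists_isGrid_discretises h.diag.obj h.prop_diag_obj
    refine ⟨_, hτ.isDiscreteSequence, fun s t hst hni => ?_⟩
    by_contra! ha
    refine hni ?_
    let α : h.diag ⋙ (evaluation ℝ≥0 C).obj s ⟶ h.diag ⋙ (evaluation ℝ≥0 C).obj t :=
      Functor.whiskerLeft h.diag ((evaluation ℝ≥0 C).map (homOfLE hst))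
    have (j : J) : IsIso (α.app j) :=
      (hd j).isIso (homOfLE hst) fun a ha' h₁ => not_le.2 (ha a ha' h₁)
    have : IsIso α := NatIso.isIso_of_isIso_app _
    let hs := isColimitOfPreserves ((evaluation ℝ≥0 C).obj s) h.isColimit
    let ht := isColimitOfPreserves ((evaluation ℝ≥0 C).obj t) h.isColimit
    have e : X.map (homOfLE hst) = (IsColimit.coconePointsIsoOfNatIso hs ht (asIso α)).hom :=
      hs.hom_ext fun j => by
        rw [IsColimit.comp_coconePointsIsoOfNatIso_hom]
        exact ((h.ι.app j).naturality (homOfLE hst)).symm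
    rw [e]
    infer_instance

instance [HasFiniteLimits C] : HasFiniteLimits (Et C) :=
  ⟨fun _ _ _ => inferInstance⟩

instance [HasFiniteColimits C] : HasFiniteColimits (Et C) :=
  ⟨fun _ _ _ => inferInstance⟩

end Limits

/-! ### Cofibrations and the model structure. -/

section Cofibrations

variable {C : Type u₁} [Category.{v₁} C]

/-- Induction on the number of terms in `(s, t]`. With `a` the last of them and `b` its predecessor
in `S`, split at `a`: from `a` to `t` the corner map is invertible. From `s` to `a`, either `b ≤ s`
and it agrees up to isomorphism with the one from `b`, or it splits at `b`, with fewer terms in `(s,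
b]`. -/
lemma cornerClass_of_discretises [HasPushouts C] {L : MorphismProperty C}
    [L.IsStableUnderCobaseChange] [L.IsMultiplicative] {S : Set ℝ≥0} (hS : IsDiscreteSequence S)
    (hS₀ : 0 ∈ S) {X Y : ℝ≥0 ⥤ C} (hX : Discretises S X) (hY : Discretises S Y) (g : X ⟶ Y)
    (h₀ : L (g.app 0))
    (h : ∀ s ∈ S, ∀ t ∈ S, ∀ u : s ⟶ t, s < t → (∀ a ∈ S, s < a → ¬ a < t) → L (corner g u)) :
    cornerClass L g := by
  have : L.RespectsIso := inferInstance
  have hiso {s t : ℝ≥0} (u : s ⟶ t) (hu : ∀ a ∈ S, s < a → ¬ a ≤ t) : IsIso (corner g u) := by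
    have := hX.isIso u hu
    have := hY.isIso u hu
    exact isIso_corner g u
  have hfin (s t : ℝ≥0) : (S ∩ Set.Ioc s t).Finite :=
    (hS.finite_inter_Iic t).subset fun a ha => ⟨ha.1, ha.2.2⟩
  have key (n : ℕ) : ∀ (s t : ℝ≥0) (u : s ⟶ t), (S ∩ Set.Ioc s t).ncard = n →
      L (corner g u) := by
    induction n using Nat.strong_induction_on with | _ n ih =>
    intro s t u hn
    by_cases hne : (S ∩ Set.Ioc s t).Nonempty
    · obtain ⟨a, ⟨haS, hsa, hat⟩, hmax⟩ := (hfin s t).exists_maximal hne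
      have ha' (x : ℝ≥0) (hx : x ∈ S) (hax : a < x) : ¬ x ≤ t := fun hxt =>
        absurd (hmax ⟨hx, hsa.trans hax, hxt⟩ hax.le) (not_le.2 hax)
      have hbfin : (S ∩ Set.Iio a).Finite :=
        (hS.finite_inter_Iic a).subset fun x hx => ⟨hx.1, (Set.mem_Iio.1 hx.2).le⟩
      obtain ⟨b, ⟨hbS, hba⟩, hbmax⟩ := hbfin.exists_maximal
        -- The predecessor exists because `0` is a term and `0 ≤ s < a`.
        ⟨0, hS₀, lt_of_le_of_lt zero_le hsa⟩
      have hba : b < a := hba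
      have hb' (x : ℝ≥0) (hx : x ∈ S) (hbx : b < x) : ¬ x < a := fun hxa =>
        absurd (hbmax ⟨hx, hxa⟩ hbx.le) (not_le.2 hbx)
      have hbaL := h b hbS a haS (homOfLE hba.le) hba hb'
      have hsaL : L (corner g (homOfLE hsa.le)) := by
        rcases le_or_gt b s with hbs | hsb
        · have := hiso (homOfLE hbs) fun x hx hbx hxs => hb' x hx hbx (hxs.trans_lt hsa)
          exact corner_mem_of_comp g (homOfLE hbs) (homOfLE hsa.le) hbaL
        · refine corner_comp_mem g (homOfLE hsb.le) (homOfLE hba.le)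
            (ih _ ?_ s b _ rfl) hbaL
          rw [← hn]
          refine Set.ncard_lt_ncard ⟨?_, fun hsub => ?_⟩ (hfin s t)
          · exact fun x hx => ⟨hx.1, hx.2.1, hx.2.2.trans (hba.le.trans hat)⟩
          · exact absurd (hsub ⟨haS, hsa, hat⟩).2.2 (not_le.2 hba)
      have := hiso (homOfLE hat) ha'
      exact corner_comp_mem g (homOfLE hsa.le) (homOfLE hat) hsaL (L.of_isIso _)
    · have := hiso u fun a ha h₁ h₂ => hne ⟨a, ha, h₁, h₂⟩
      exact L.of_isIso _
  have hcorner (s t : ℝ≥0) (u : s ⟶ t) : L (corner g u) := key _ s t u rfl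
  exact ⟨fun t => app_mem_of_corner_mem g (homOfLE (zero_le (a := t))) h₀ (hcorner _ _ _), hcorner⟩

variable [ModelCategory C]

lemma etCofibrations_iff {X Y : Et C} (g : X ⟶ Y) :
    etCofibrations C g ↔ cornerClass (cofibrations C) g.hom := by
  constructor
  · rintro ⟨S, hS, hS₀, hX, hY, h₀, h⟩
    exact cornerClass_of_discretises hS hS₀ hX hY g.hom h₀.mem
      fun s hs t ht _ hst hgap => (h s hs t ht hst fun a ha h' => hgap a ha h'.1 h'.2).mem
  · intro h
    obtain ⟨τ, hτ, hd⟩ := exists_isGrid_discretises ![X.obj, Y.obj] (by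
      intro k; fin_cases k <;> exact ObjectProperty.FullSubcategory.property _)
    exact ⟨_, hτ.isDiscreteSequence, ⟨0, hτ.zero⟩, hd 0, hd 1, ⟨h.1 0⟩,
      fun _ _ _ _ _ _ => ⟨h.2 _ _ _⟩⟩

/-- For the converse, `g.app t` is a cobase change of the trivial cofibration `g.app s` followed by
the corner map; two-out-of-three applies. -/
lemma cornerClass_trivialCofibrations_iff {J : Type*} [Category J] {X Y : J ⥤ C} (g : X ⟶ Y) :
    cornerClass (trivialCofibrations C) g ↔
      cornerClass (cofibrations C) g ∧ ∀ t, WeakEquivalence (g.app t) := by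
  constructor
  · exact fun h => ⟨⟨fun t => (h.1 t).1, fun s t u => (h.2 s t u).1⟩, fun t => ⟨(h.1 t).2⟩⟩
  · rintro ⟨h, hw⟩
    refine ⟨fun t => ⟨h.1 t, (hw t).mem⟩, fun s t u => ⟨h.2 s t u, ?_⟩⟩
    have : Cofibration (g.app s) := ⟨h.1 s⟩
    have := hw s
    have : WeakEquivalence (pushout.inr (g.app s) (X.map u) ≫ corner g u) := by
      rw [inr_corner]; exact hw t
    exact (weakEquivalence_of_precomp (pushout.inr (g.app s) (X.map u)) (corner g u)).mem

variable (C) in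
/-- The model structure on extended tame functors with pointwise weak equivalences and
fibrations. -/
noncomputable abbrev etModelCategory : ModelCategory (Et C) where
  categoryWithFibrations := ⟨etFibrations C⟩
  categoryWithCofibrations := ⟨etCofibrations C⟩
  categoryWithWeakEquivalences := ⟨etWeakEquivalences C⟩
  cm2 :=
    { comp_mem f g hf hg t := by
        have := hf t
        have := hg t
        exact inferInstanceAs (WeakEquivalence (f.hom.app t ≫ g.hom.app t))
      of_postcomp f g hg hfg t := by
        have := hg t
        have : WeakEquivalence (f.hom.app t ≫ g.hom.app t) := hfg t
        exact weakEquivalence_of_postcomp (f.hom.app t) (g.hom.app t)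
      of_precomp f g hf hfg t := by
        have := hf t
        have : WeakEquivalence (f.hom.app t ≫ g.hom.app t) := hfg t
        exact weakEquivalence_of_precomp (f.hom.app t) (g.hom.app t) }
  cm3a := ⟨fun h hg t => ⟨of_retract (P := weakEquivalences C)
    (h.map ((isExtendedTame C).ι ⋙ (evaluation ℝ≥0 C).obj t)) (hg t).mem⟩⟩
  cm3b := ⟨fun h hg t => ⟨of_retract (P := fibrations C)
    (h.map ((isExtendedTame C).ι ⋙ (evaluation ℝ≥0 C).obj t)) (hg t).mem⟩⟩
  cm3c := ⟨fun h hg => (etCofibrations_iff _).2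
    (of_retract (P := cornerClass (cofibrations C)) (h.map (isExtendedTame C).ι)
      ((etCofibrations_iff _).1 hg))⟩
  cm4a i p hi hw hp := et_hasLiftingProperty (L := trivialCofibrations C) (R := fibrations C)
    (fun _ _ _ _ i p hi hp => hasLiftingProperty_of_wfs i p hi hp)
    ((cornerClass_trivialCofibrations_iff _).2 ⟨(etCofibrations_iff i).1 hi.mem, hw.mem⟩)
    fun t => (hp.mem t).mem
  cm4b i p hi hp hw := et_hasLiftingProperty (L := cofibrations C) (R := trivialFibrations C)
    (fun _ _ _ _ i p hi hp => hasLiftingProperty_of_wfs i p hi hp)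
    ((etCofibrations_iff i).1 hi.mem)
    fun t => ⟨(hp.mem t).mem, (hw.mem t).mem⟩
  cm5a := ⟨fun f => by
    obtain ⟨Z, i, p, fac, hi, hp⟩ := et_exists_factorization (L := trivialCofibrations C)
      (R := fibrations C) f
    have hi' := (cornerClass_trivialCofibrations_iff _).1 hi
    exact ⟨⟨Z, i, p, fac, ⟨(etCofibrations_iff i).2 hi'.1, hi'.2⟩, fun t => ⟨hp t⟩⟩⟩⟩
  cm5b := ⟨fun f => by
    obtain ⟨Z, i, p, fac, hi, hp⟩ := et_exists_factorization (L := cofibrations C)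
      (R := trivialFibrations C) f
    exact ⟨⟨Z, i, p, fac, (etCofibrations_iff i).2 hi,
      ⟨fun t => ⟨(hp t).1⟩, fun t => ⟨(hp t).2⟩⟩⟩⟩⟩

lemma isStandardModelStructure_etModelCategory :
    IsStandardModelStructure (etModelCategory C) := ⟨rfl, rfl, rfl⟩

end Cofibrations

end ExtendedTame
namespace ExtendedTame

open PartialQuillen

/-! ### Pointwise criteria and the induced adjunction. -/

section

variable {C : Type u₁} [Category.{v₁} C]

/-- Evaluation of extended tame functors at a time. -/
abbrev etEvaluation (C : Type u₁) [Category.{v₁} C] (t : ℝ≥0) : Et C ⥤ C :=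
  (isExtendedTame C).ι ⋙ (evaluation ℝ≥0 C).obj t

variable [ModelCategory C]

attribute [local instance] etModelCategory

lemma et_weakEquivalence_iff {X Y : Et C} (f : X ⟶ Y) :
    WeakEquivalence f ↔ ∀ t, WeakEquivalence (f.hom.app t) :=
  weakEquivalence_iff f

lemma et_fibration_iff {X Y : Et C} (f : X ⟶ Y) :
    Fibration f ↔ ∀ t, Fibration (f.hom.app t) :=
  fibration_iff f

lemma et_cofibration_iff {X Y : Et C} (f : X ⟶ Y) :
    Cofibration f ↔ cornerClass (cofibrations C) f.hom :=
  (cofibration_iff f).trans (etCofibrations_iff f)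

lemma et_cofibration_app {X Y : Et C} {f : X ⟶ Y} (hf : Cofibration f) (t : ℝ≥0) :
    Cofibration (f.hom.app t) :=
  ⟨((et_cofibration_iff f).1 hf).1 t⟩

/-- Evaluation at `t` preserves initial objects and cofibrations. -/
lemma et_isCofibrant_obj {X : Et C} (hX : IsCofibrant X) (t : ℝ≥0) :
    IsCofibrant (X.obj.obj t) :=
  (isCofibrant_iff_of_isInitial ((initial.to X).hom.app t)
    (initialIsInitial.isInitialObj (etEvaluation C t))).2 (et_cofibration_app hX t)

lemma et_isFibrant_obj {X : Et C} (hX : IsFibrant X) (t : ℝ≥0) :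
    IsFibrant (X.obj.obj t) :=
  (isFibrant_iff_of_isTerminal ((terminal.from X).hom.app t)
    (terminalIsTerminal.isTerminalObj (etEvaluation C t))).2 ((et_fibration_iff _).1 hX t)

lemma et_isCofibrantReplacement_app {X Y : Et C} {q : X ⟶ Y} (hq : IsCofibrantReplacement q)
    (t : ℝ≥0) : IsCofibrantReplacement (q.hom.app t) where
  isCofibrant := et_isCofibrant_obj hq.isCofibrant t
  fibration := (et_fibration_iff q).1 hq.fibration t
  weakEquivalence := (et_weakEquivalence_iff q).1 hq.weakEquivalence t

lemma et_isFibrantReplacement_app {X Y : Et C} {r : X ⟶ Y} (hr : IsFibrantReplacement r)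
    (t : ℝ≥0) : IsFibrantReplacement (r.hom.app t) where
  isFibrant := et_isFibrant_obj hr.isFibrant t
  cofibration := et_cofibration_app hr.cofibration t
  weakEquivalence := (et_weakEquivalence_iff r).1 hr.weakEquivalence t

lemma weaklyEquivalent_obj {X Y : Et C} (h : WeaklyEquivalent X Y) (t : ℝ≥0) :
    WeaklyEquivalent (X.obj.obj t) (Y.obj.obj t) := by
  induction h with
  | rel X Y h =>
    obtain ⟨f, hf⟩ := h
    exact .rel _ _ ⟨f.hom.app t, (et_weakEquivalence_iff f).1 hf t⟩
  | refl X => exact .refl _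
  | symm X Y _ ih => exact .symm _ _ ih
  | trans X Y Z _ _ ih₁ ih₂ => exact .trans _ _ _ ih₁ ih₂

lemma closedUnderWeakEquivalences_etObjects {C₀ : ObjectProperty C}
    (h : ClosedUnderWeakEquivalences C₀) : ClosedUnderWeakEquivalences (etObjects C₀) :=
  fun _ _ hXY hX t => h _ _ (weaklyEquivalent_obj hXY t) (hX t)

variable {D : Type u₂} [Category.{v₂} D] [ModelCategory D] {F : C ⥤ D} {U : D ⥤ C}
  {adj : F ⊣ U}

lemma isQuillenAdjunction_etAdjunction (h : IsQuillenAdjunction adj) :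
    IsQuillenAdjunction (etAdjunction adj) where
  map_cofibration f hf := by
    have : PreservesColimitsOfShape WalkingSpan F :=
      adj.leftAdjoint_preservesColimits.preservesColimitsOfShape
    exact (et_cofibration_iff _).2 (cornerClass_whiskerRight F
      (fun _ _ g hg => (h.map_cofibration g ⟨hg⟩).mem) ((et_cofibration_iff f).1 hf))
  map_fibration f hf :=
    (et_fibration_iff _).2 fun t => h.map_fibration _ ((et_fibration_iff f).1 hf t)

lemma isPartialQuillenEquivalence_etAdjunction {C₀ : ObjectProperty C} {D₀ : ObjectProperty D}
    (h : IsPartialQuillenEquivalence adj C₀ D₀) :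
    IsPartialQuillenEquivalence (etAdjunction adj) (etObjects C₀) (etObjects D₀) where
  toIsQuillenAdjunction := isQuillenAdjunction_etAdjunction h.toIsQuillenAdjunction
  closed_left := closedUnderWeakEquivalences_etObjects h.closed_left
  closed_right := closedUnderWeakEquivalences_etObjects h.closed_right
  obj_left _ hX hX₀ t := h.obj_left _ (et_isCofibrant_obj hX t) (hX₀ t)
  obj_right _ hY hY₀ t := h.obj_right _ (et_isFibrant_obj hY t) (hY₀ t)
  derivedUnit_weakEquivalence _ hX hX₀ _ r hr := (et_weakEquivalence_iff _).2 fun t =>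
    h.derivedUnit_weakEquivalence _ (et_isCofibrant_obj hX t) (hX₀ t) _ (r.hom.app t)
      (et_isFibrantReplacement_app hr t)
  derivedCounit_weakEquivalence _ hY hY₀ _ q hq := (et_weakEquivalence_iff _).2 fun t =>
    h.derivedCounit_weakEquivalence _ (et_isFibrant_obj hY t) (hY₀ t) _ (q.hom.app t)
      (et_isCofibrantReplacement_app hq t)

end

end ExtendedTame

theorem proposition4p5 {C : Type u₁} [Category.{v₁} C] [ModelCategory C]
    {D : Type u₂} [Category.{v₂} D] [ModelCategory D]
    {F : C ⥤ D} {U : D ⥤ C} (adj : F ⊣ U)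
    (C₀ : ObjectProperty C) (D₀ : ObjectProperty D)
    (hFU : PartialQuillen.IsPartialQuillenEquivalence adj C₀ D₀) :
    ∃ (mC : ModelCategory (ExtendedTame.Et C)) (mD : ModelCategory (ExtendedTame.Et D)),
      ExtendedTame.IsStandardModelStructure mC ∧
      ExtendedTame.IsStandardModelStructure mD ∧
      PartialQuillen.IsQuillenAdjunction (ExtendedTame.etAdjunction adj) ∧
      PartialQuillen.IsPartialQuillenEquivalence (ExtendedTame.etAdjunction adj)
        (ExtendedTame.etObjects C₀) (ExtendedTame.etObjects D₀) :=
  ⟨ExtendedTame.etModelCategory C, ExtendedTame.etModelCategory D,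
    ExtendedTame.isStandardModelStructure_etModelCategory,
    ExtendedTame.isStandardModelStructure_etModelCategory,
    ExtendedTame.isQuillenAdjunction_etAdjunction hFU.toIsQuillenAdjunction,
    ExtendedTame.isPartialQuillenEquivalence_etAdjunction hFU⟩
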